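/- Let $n\ge 1$. A signed permutation of $[n]=\{1,\dots,n\}$ is a bijection $\sigma$ of $\{-n,\dots,-1,1,\dots,n\}$ onto itself with $\sigma(-i)=-\sigma(i)$ for all $i$; write $\sigma_i=\sigma(i)$. Let $B_n$ be the set of signed permutations of $[n]$, let $\mathrm{neg}(\sigma)=\#\{i\in[n]:\sigma_i<0\}$, and let $D_n=\{\sigma\in B_n:\mathrm{neg}(\sigma)\text{ is even}\}$. Put $\mathrm{wex}(\sigma)=\#\{i\in[n]:\sigma_i\ge i\}$ and $\mathrm{fwex}(\sigma)=2\,\mathrm{wex}(\sigma)+\mathrm{neg}(\sigma)$, and let $\mathrm{cro}_B(\sigma)$ be the number of pairs $(i,j)\in[n]^2$ such that $i<j\le\sigma_i<\sigma_j$, or $-i<j\le-\sigma_i<\sigma_j$, or $i>j>\sigma_i>\sigma_j$. On polynomials in $t$ with coefficients in $\mathbb Z[q]$ let $(Df)(t)=\frac{f(qt)-f(t)}{(q-1)t}$, let $U$ be multiplication by $t$, and let $R_m(t,q)=(D+DUU)^m\,1$ for $m\ge 0$. Then the following identities hold in $\mathbb Z[t,q]$: 1. $\displaystyle\sum_{\sigma\in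 B_n}(-1)^{\lfloor \mathrm{fwex}(\sigma)/2\rfloor}\,t^{\mathrm{neg}(\sigma)}q^{\mathrm{cro}_B(\sigma)}=\left[(-1)^{\lfloor (n+1)/2\rfloor}+(-1)^{\lfloor n/2\rfloor}\,t\right]R_{n-1}(t,q).$ 2. $\displaystyle\sum_{\sigma\in D_n}(-1)^{\lfloor \mathrm{fwex}(\sigma)/2\rfloor}\,t^{\mathrm{neg}(\sigma)}q^{\mathrm{cro}_B(\sigma)}=\begin{cases}(-1)^{n/2}\,t\,R_{n-1}(t,q)&\text{if } n \text{ is even},\\(-1)^{(n+1)/2}\,R_{n-1}(t,q)&\text{if } n\text{ is odd}.\end{cases}$ -/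

import Mathlib

open Polynomial

namespace SignedCount

/-- The finite set `[±n] = {-n, …, -1, 1, …, n}` of integers. -/
noncomputable abbrev pm (n : ℕ) : Finset ℤ := (Finset.Icc (-(n : ℤ)) (n : ℤ)).erase 0

/-- `B_n`: the bijections `σ` of `[±n]` onto itself with `σ(-i) = -σ(i)` for all `i ∈ [±n]`. -/
noncomputable def signedPerms (n : ℕ) : Finset (Equiv.Perm (pm n)) :=
  Finset.univ.filter fun σ => ∀ i j : pm n, (j : ℤ) = -(i : ℤ) → (σ j : ℤ) = -(σ i : ℤ)

/-- `neg(σ)`: the number of negative entries of the window `σ_1 σ_2 ⋯ σ_n`. -/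
noncomputable def neg {n : ℕ} (σ : Equiv.Perm (pm n)) : ℕ :=
  (Finset.univ.filter fun i : pm n => 0 < (i : ℤ) ∧ (σ i : ℤ) < 0).card

/-- `wex(σ)`: the number of `i ∈ [n]` with `σ_i ≥ i`. -/
noncomputable def wex {n : ℕ} (σ : Equiv.Perm (pm n)) : ℕ :=
  (Finset.univ.filter fun i : pm n => 0 < (i : ℤ) ∧ (i : ℤ) ≤ (σ i : ℤ)).card

/-- The flag weak excedance number `fwex(σ) = 2 wex(σ) + neg(σ)`. -/
noncomputable def fwex {n : ℕ} (σ : Equiv.Perm (pm n)) : ℕ := 2 * wex σ + neg σ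

/-- `(i, j)` is a crossing of `σ` (with `σ_i = σ(i)`, `σ_j = σ(j)` as integers). -/
def IsCrossing {n : ℕ} (σ : Equiv.Perm (pm n)) (i j : pm n) : Prop :=
  0 < (i : ℤ) ∧ 0 < (j : ℤ) ∧
    (((i : ℤ) < j ∧ (j : ℤ) ≤ σ i ∧ (σ i : ℤ) < σ j) ∨
      (-(i : ℤ) < j ∧ (j : ℤ) ≤ -(σ i : ℤ) ∧ -(σ i : ℤ) < σ j) ∨
      ((j : ℤ) < i ∧ (σ i : ℤ) < j ∧ (σ j : ℤ) < σ i))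

instance {n : ℕ} (σ : Equiv.Perm (pm n)) (i j : pm n) : Decidable (IsCrossing σ i j) := by
  unfold IsCrossing
  infer_instance

/-- `cro_B(σ)`: the number of crossings of `σ`. -/
noncomputable def croB {n : ℕ} (σ : Equiv.Perm (pm n)) : ℕ :=
  (Finset.univ.filter fun p : pm n × pm n => IsCrossing σ p.1 p.2).card

/-- `D_n`: the even-signed permutations. -/
noncomputable def evenSignedPerms (n : ℕ) : Finset (Equiv.Perm (pm n)) :=
  (signedPerms n).filter fun σ => Even (neg σ)

/-- The indeterminate `q`. The identities live in `ℤ[q][t]`: polynomials in `t` whose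
coefficients are polynomials in `q`. -/
noncomputable def q : ℤ[X][X] := C X

/-- The indeterminate `t`. -/
noncomputable def t : ℤ[X][X] := X

/-- The `q`-derivative `D`, the `ℤ[q]`-linear operator on `ℤ[q][t]` with
`D(t^m) = [m]_q t^(m-1)`, where `[m]_q = 1 + q + ⋯ + q^(m-1)`. See `qDeriv_spec` and
`qDeriv_unique`: `D f` is the only polynomial equal to `(f(qt) - f(t)) / ((q - 1) t)`. -/
noncomputable def qDeriv : Module.End ℤ[X] ℤ[X][X] :=
  Polynomial.lsum fun m => (∑ i ∈ Finset.range m, (X : ℤ[X]) ^ i) • Polynomial.monomial (m - 1)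

theorem qDeriv_spec (f : ℤ[X][X]) : (q - 1) * t * qDeriv f = f.comp (q * t) - f := by
  induction f using Polynomial.induction_on' with
  | add f g hf hg => rw [map_add, mul_add, hf, hg, add_comp]; ring
  | monomial m a =>
    have h : qDeriv (monomial m a) =
        C (∑ i ∈ Finset.range m, (X : ℤ[X]) ^ i) * (C a * X ^ (m - 1)) := by
      rw [qDeriv, Polynomial.lsum_apply, Polynomial.sum_monomial_index _ _ (by simp),
        LinearMap.smul_apply, ← C_mul_X_pow_eq_monomial, smul_eq_C_mul]
    have g : (q - 1 : ℤ[X][X]) * C (∑ i ∈ Finset.range m, (X : ℤ[X]) ^ i) = q ^ m - 1 := by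
      rw [map_sum]
      simp only [map_pow]
      rw [mul_comm]
      exact geom_sum_mul q m
    rw [h, monomial_comp, ← C_mul_X_pow_eq_monomial]
    rcases m with _ | m
    · simp
    · rw [show (q - 1) * t * (C (∑ i ∈ Finset.range (m + 1), (X : ℤ[X]) ^ i) *
          (C a * X ^ (m + 1 - 1))) =
          ((q - 1) * C (∑ i ∈ Finset.range (m + 1), (X : ℤ[X]) ^ i)) * (C a * X ^ (m + 1)) by
        rw [t, Nat.add_sub_cancel]; ring, g, t]
      ring

theorem qDeriv_unique (f g : ℤ[X][X]) (h : (q - 1) * t * g = f.comp (q * t) - f) :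
    g = qDeriv f := by
  have hq : (q - 1 : ℤ[X][X]) ≠ 0 := by
    rw [q, ← C_1, ← C_sub, Ne, C_eq_zero]
    exact X_sub_C_ne_zero (1 : ℤ)
  have ht : t ≠ 0 := X_ne_zero
  exact mul_left_cancel₀ (mul_ne_zero hq ht) (h.trans (qDeriv_spec f).symm)

/-- The operator `U`: multiplication by `t`. -/
noncomputable def mulT : Module.End ℤ[X] ℤ[X][X] := LinearMap.mulLeft ℤ[X] t

/-- `R_n(t, q) = (D + DUU)^n 1`; products and powers of operators are compositions. -/
noncomputable def R (n : ℕ) : ℤ[X][X] := ((qDeriv + qDeriv * mulT * mulT) ^ n) 1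

end SignedCount

/-! Since `⌊fwex/2⌋ = wex + ⌊neg/2⌋`, the sign depends only on `wex` and on the exponent of `t`. It
therefore suffices to know `S_n`, the generating polynomial weighted by `(-1)^wex t^neg q^cro`,
coefficient by coefficient in `t`.

The core is the recurrence `S_{n+1} = (t - 1) D((1 + t) S_n)` (`signedSum_succ`), found by deleting
the smallest position. Its sign affects no crossing; a positive entry there is a weak excedance and
a negative one contributes `t`, whence the factor `t - 1`. If the smallest value sits in that
position, `S_n` remains. Otherwise it sits at some other position `b`, whose sign is free: taking
`b` as negative in the smaller permutation, the two choices yield a factor `1 + qt`. The remaining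
sum over negative `b` carries an excess weight `q^(2 numBelow)`. Moving `b` to the front of the
negative positions turns this into `q^(negRank)` (`sum_pow_cross_add_numBelow`), and summing over
`b` gives `[neg]_q`, that is, `D S_n`. The q-Leibniz rule combines the two cases.

Hence `S_{m+1} = (t - 1) (D(t² - 1))^m 1`. Compared with `D + DUU`, only the degree-lowering part
has changed sign. Reaching `t^k` in `m` steps takes `(m - k)/2` lowerings, so the coefficients
differ from those of `R_m` by `(-1)^((m-k)/2)` (`coeff_signedR_and_R`). As `R_m` has the parity of
`m`, restricting to even `neg` retains exactly one of the two terms. -/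

namespace SignedCount

/-! ### Permutations with sign vectors, and deletion of the smallest position -/

/-- The crossing condition for positions `i`, `j` with absolute values `x`, `y` and signs
`a`, `b` (`true` for a negative entry). -/
def CrossCond (i j x y : ℕ) (a b : Bool) : Prop :=
  (a = false ∧ b = false ∧ ((i < j ∧ j ≤ x ∧ x < y) ∨ (j < i ∧ x < j ∧ y < x))) ∨
  (a = true ∧ b = false ∧ j ≤ x ∧ x < y) ∨
  (a = false ∧ b = true ∧ j < i ∧ x < j) ∨
  (a = true ∧ b = true ∧ j < i ∧ x < y)

instance (i j x y : ℕ) (a b : Bool) : Decidable (CrossCond i j x y a b) := by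
  unfold CrossCond
  infer_instance

/-- The number of crossings of the signed permutation with absolute values `e` and signs `s`. -/
def cross {n : ℕ} (e : Equiv.Perm (Fin n)) (s : Fin n → Bool) : ℕ :=
  ∑ i : Fin n, ∑ j : Fin n, if CrossCond i j (e i) (e j) (s i) (s j) then 1 else 0

/-- The number of weak excedances of the signed permutation `(e, s)`. -/
def weakExc {n : ℕ} (e : Equiv.Perm (Fin n)) (s : Fin n → Bool) : ℕ :=
  ∑ i, if s i = false ∧ i ≤ e i then 1 else 0

/-- The number of negative entries for the signs `s`. -/
def numNeg {n : ℕ} (s : Fin n → Bool) : ℕ := ∑ i, if s i = true then 1 else 0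

/-- The number of negative positions `j < b` with `e j < e b`. -/
def numBelow {n : ℕ} (e : Equiv.Perm (Fin n)) (s : Fin n → Bool) (b : Fin n) : ℕ :=
  ∑ j, if s j = true ∧ j < b ∧ e j < e b then 1 else 0

/-- The number of negative positions `j < b`. -/
def negRank {n : ℕ} (s : Fin n → Bool) (b : Fin n) : ℕ :=
  ∑ j, if s j = true ∧ j < b then 1 else 0

theorem cross_decomposeFin_zero {n : ℕ} (e : Equiv.Perm (Fin n)) (c : Bool) (s : Fin n → Bool) :
    cross (Equiv.Perm.decomposeFin.symm (0, e)) (Fin.cons c s) = cross e s := by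
  simp only [cross, Fin.sum_univ_succ (n := n), Fin.cons_zero, Fin.cons_succ,
    Equiv.Perm.decomposeFin_symm_apply_zero, Equiv.Perm.decomposeFin_symm_apply_succ]
  simp [CrossCond]

theorem weakExc_decomposeFin_zero {n : ℕ} (e : Equiv.Perm (Fin n)) (c : Bool)
    (s : Fin n → Bool) :
    weakExc (Equiv.Perm.decomposeFin.symm (0, e)) (Fin.cons c s) =
      (if c = false then 1 else 0) + weakExc e s := by
  simp only [weakExc, Fin.sum_univ_succ (n := n)]
  simp

theorem numNeg_cons {n : ℕ} (c : Bool) (s : Fin n → Bool) :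
    numNeg (Fin.cons c s : Fin (n + 1) → Bool) = (if c = true then 1 else 0) + numNeg s := by
  simp only [numNeg, Fin.sum_univ_succ (n := n), Fin.cons_zero, Fin.cons_succ]

theorem decomposeFin_symm_succ_apply {n : ℕ} (e : Equiv.Perm (Fin n)) (b x : Fin n) :
    Equiv.Perm.decomposeFin.symm ((e b).succ, e) x.succ = if x = b then 0 else (e x).succ := by
  rw [Equiv.Perm.decomposeFin_symm_apply_succ]
  split_ifs with h
  · simp [h]
  · exact Equiv.swap_apply_of_ne_of_ne (Fin.succ_ne_zero _) (by simpa using h)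

/-- Position `b.succ` receives the smallest value, so it is never a weak excedance, whatever its
sign; declaring `b` negative has the same effect. -/
theorem weakExc_decomposeFin_succ {n : ℕ} (e : Equiv.Perm (Fin n)) (c : Bool)
    (s : Fin n → Bool) (b : Fin n) :
    weakExc (Equiv.Perm.decomposeFin.symm ((e b).succ, e)) (Fin.cons c s) =
      (if c = false then 1 else 0) + weakExc e (Function.update s b true) := by
  simp only [weakExc, Fin.sum_univ_succ, decomposeFin_symm_succ_apply,
    Equiv.Perm.decomposeFin_symm_apply_zero, Fin.cons_zero, Fin.cons_succ]
  congr 1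
  · simp
  · refine Finset.sum_congr rfl fun x _ => ?_
    by_cases h : x = b <;> simp [h]

/-- Compares with the smaller permutation in which `b` keeps its value `e b` and is made negative.
The true sign of `b` then costs only the last term, which becomes the factor `1 + q t` after summing
over that sign. -/
theorem cross_decomposeFin_succ {n : ℕ} (e : Equiv.Perm (Fin n)) (c : Bool)
    (s : Fin n → Bool) (b : Fin n) :
    cross (Equiv.Perm.decomposeFin.symm ((e b).succ, e)) (Fin.cons c s) =
      cross e (Function.update s b true) + 2 * numBelow e s b +
        (if s b = true then 1 else 0) := by
  simp only [cross, Fin.sum_univ_succ (n := n), decomposeFin_symm_succ_apply,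
    Equiv.Perm.decomposeFin_symm_apply_zero, Fin.cons_zero, Fin.cons_succ]
  have inj : ∀ x, x ≠ b → (e x : ℕ) ≠ e b := fun x hx h => hx (e.injective (Fin.ext h))
  have inj' : ∀ x, x ≠ b → (x : ℕ) ≠ b := fun x hx h => hx (Fin.ext h)
  set S := Function.update s b true with hS
  have hSb : S b = true := by simp [hS]
  have hSn : ∀ x, x ≠ b → S x = s x := fun x hx => by simp [hS, hx]
  -- row and column of the new position
  have h00 : (if CrossCond (0 : Fin (n + 1)) (0 : Fin (n + 1)) (e b).succ (e b).succ c c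
      then 1 else 0) = 0 := by
    simp [CrossCond]
  have hrow : ∀ j : Fin n, (if CrossCond ((0 : Fin (n + 1)) : ℕ) (j.succ : ℕ) (e b).succ
      ((if j = b then 0 else (e j).succ : Fin (n + 1)) : ℕ) c (s j) then 1 else 0) =
      if s j = false ∧ (j : ℕ) ≤ e b ∧ (e b : ℕ) < e j then 1 else 0 := by
    intro j
    by_cases h : j = b
    · subst h; simp [CrossCond]
    · cases c <;> simp [CrossCond, h]
  have hcol : ∀ i : Fin n, (if CrossCond (i.succ : ℕ) ((0 : Fin (n + 1)) : ℕ)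
      ((if i = b then 0 else (e i).succ : Fin (n + 1)) : ℕ) (e b).succ (s i) c then 1 else 0) =
      if s i = true ∧ (e i : ℕ) ≤ e b then 1 else 0 := by
    intro i
    by_cases h : i = b
    · subst h; cases c <;> simp [CrossCond]
    · have := inj i h
      cases c <;> cases h' : s i <;> simp [CrossCond, h]
      all_goals simp only [Fin.lt_def, Fin.le_def]
      all_goals exact if_congr (by omega) rfl rfl
  -- Only pairs meeting `b` change. Losses and gains are added on opposite sides, so that no
  -- subtraction in `ℕ` occurs.
  have hin : ∀ i j : Fin n, (if CrossCond (i.succ : ℕ) (j.succ : ℕ)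
        ((if i = b then 0 else (e i).succ : Fin (n + 1)) : ℕ)
        ((if j = b then 0 else (e j).succ : Fin (n + 1)) : ℕ) (s i) (s j) then 1 else 0)
      + (if i = b then (if s j = false ∧ (j : ℕ) ≤ e b ∧ (e b : ℕ) < e j then 1 else 0) +
          (if s j = true ∧ (j : ℕ) < b ∧ (e b : ℕ) < e j then 1 else 0) else 0)
      + (if j = b then (if s i = true ∧ (b : ℕ) < i ∧ (e i : ℕ) < e b then 1 else 0) else 0)
      = (if CrossCond i j (e i) (e j) (S i) (S j) then 1 else 0) +
        (if i = b then (if s j = true ∧ (j : ℕ) < b then 1 else 0) else 0) := by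
    intro i j
    by_cases hi : i = b
    · subst hi
      by_cases hj : j = i
      · subst hj; cases h : s j <;> simp [CrossCond]
      · rw [hSb, hSn j hj]
        cases h : s i <;> cases h' : s j <;> simp [CrossCond, hj]
        all_goals grind
    · by_cases hj : j = b
      · subst hj
        rw [hSb, hSn i hi]
        cases h : s i <;> cases h' : s j <;> simp [CrossCond, hi]
      · rw [hSn i hi, hSn j hj]
        simp [CrossCond, hi, hj]
  have hin' := Finset.sum_congr rfl fun i (_ : i ∈ Finset.univ) =>
    Finset.sum_congr rfl fun j (_ : j ∈ Finset.univ) => hin i j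
  simp only [Finset.sum_add_distrib] at hin'
  simp only [Finset.sum_ite_irrel, Finset.sum_const_zero, Finset.sum_ite_eq', Finset.mem_univ,
    if_true, Finset.sum_add_distrib] at hin'
  simp only [h00, hrow, hcol, Finset.sum_add_distrib]
  -- Compares `x` with `b` in position and in value. A negative `x` below `b` in both respects is
  -- counted twice on the left, which is the source of `2 * numBelow`.
  have hcount : ∀ x : Fin n,
      (if s x = true ∧ (e x : ℕ) ≤ e b then 1 else 0) +
        (if s x = true ∧ (x : ℕ) < b then 1 else 0) =
      (if s x = true ∧ (x : ℕ) < b ∧ (e b : ℕ) < e x then 1 else 0) +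
        (if s x = true ∧ (b : ℕ) < x ∧ (e x : ℕ) < e b then 1 else 0) +
        2 * (if s x = true ∧ x < b ∧ e x < e b then 1 else 0) +
        (if x = b then (if s b = true then 1 else 0) else 0) := by
    intro x
    by_cases hx : x = b
    · subst hx; simp
    · have h1 := inj x hx
      have h2 := inj' x hx
      simp only [hx, Fin.lt_def, if_false]
      cases h : s x <;> simp only [true_and, false_and, if_false, reduceCtorEq]
      split_ifs <;> omega
  have hcount' := Finset.sum_congr rfl fun x (_ : x ∈ Finset.univ) => hcount x
  simp only [Finset.sum_add_distrib, ← Finset.mul_sum, Finset.sum_ite_eq', Finset.mem_univ,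
    if_true] at hcount'
  simp only [numBelow]
  omega

/-! ### Moving a negative position to the front -/

theorem cycleRange_lt_cycleRange_iff {k : ℕ} (r i j : Fin k) :
    r.cycleRange j < r.cycleRange i ↔ i ≠ r ∧ (j = r ∨ j < i) := by
  have key : ∀ x : Fin k, (r.cycleRange x : ℕ) =
      if x < r then (x : ℕ) + 1 else if x = r then 0 else (x : ℕ) := by
    intro x
    split_ifs with h h'
    · exact Fin.coe_cycleRange_of_lt h
    · have : NeZero k := ⟨by have := x.isLt; omega⟩
      subst h'
      rw [Fin.cycleRange_self]
      simp
    · rw [Fin.cycleRange_of_gt (lt_of_le_of_ne (not_lt.mp h) (Ne.symm h'))]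
  rw [Fin.lt_def, key, key]
  simp only [Fin.lt_def, Fin.ext_iff, ne_eq]
  split_ifs <;> omega

/-- A permutation of the negative positions that moves `b` to the front. -/
theorem exists_perm_to_front {n : ℕ} (s : Fin n → Bool) {b : Fin n} (hb : s b = true) :
    ∃ g : Equiv.Perm (Fin n), (∀ x, s x = false → g x = x) ∧ (∀ x, s (g x) = s x) ∧
      ∀ i j, s i = true → s j = true → (g j < g i ↔ i ≠ b ∧ (j = b ∨ j < i)) := by
  -- `f` lists the negative positions in increasing order; `d` is the cycle that brings `b`, of rank
  -- `r`, to rank zero and keeps the order of the others.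
  let f : Fin _ ≃o {x // s x = true} := monoEquivOfFin {x // s x = true} rfl
  let r := f.symm ⟨b, hb⟩
  let d : Equiv.Perm {x // s x = true} := f.toEquiv.permCongr r.cycleRange
  have hd : ∀ x (hx : s x = true), Equiv.Perm.ofSubtype d x = d ⟨x, hx⟩ :=
    fun x hx => Equiv.Perm.ofSubtype_apply_of_mem d hx
  have hd' : ∀ x, s x = false → Equiv.Perm.ofSubtype d x = x :=
    fun x hx => Equiv.Perm.ofSubtype_apply_of_not_mem d (by simp [hx])
  refine ⟨Equiv.Perm.ofSubtype d, hd', fun x => ?_, fun i j hi hj => ?_⟩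
  · cases hx : s x
    · rw [hd' x hx, hx]
    · rw [hd x hx]
      exact (d ⟨x, hx⟩).2
  · rw [hd i hi, hd j hj, Subtype.coe_lt_coe]
    have h1 : ∀ x, d x = f (r.cycleRange (f.symm x)) := fun x => rfl
    rw [h1, h1, f.lt_iff_lt, cycleRange_lt_cycleRange_iff, f.symm.lt_iff_lt]
    simp [r]

theorem cross_eq_sum {n : ℕ} (e : Equiv.Perm (Fin n)) (s : Fin n → Bool) :
    cross e s =
      (∑ i, ∑ j, if s i = false ∧ s j = false ∧
        ((i < j ∧ j ≤ e i ∧ e i < e j) ∨ (j < i ∧ e i < j ∧ e j < e i)) then 1 else 0) +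
      (∑ j, ∑ i, if s i = true ∧ s j = false ∧ j ≤ e i ∧ e i < e j then 1 else 0) +
      (∑ i, ∑ j, if s i = false ∧ s j = true ∧ j < i ∧ e i < j then 1 else 0) +
      (∑ i, ∑ j, if s i = true ∧ s j = true ∧ j < i ∧ e i < e j then 1 else 0) := by
  rw [Finset.sum_comm (γ := Fin n) (f := fun j i =>
    if s i = true ∧ s j = false ∧ j ≤ e i ∧ e i < e j then 1 else 0)]
  simp only [← Finset.sum_add_distrib, cross, CrossCond, Fin.lt_def, Fin.le_def]
  refine Finset.sum_congr rfl fun i _ => Finset.sum_congr rfl fun j _ => ?_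
  cases s i <;> cases s j <;> simp

/-- Mixed crossings involve a negative entry only through its value or only through its position, so
rearranging the negative entries preserves their number. Crossings between two negatives are
inversions of absolute values, and moving `b` to the front alters only those that involve `b`. -/
theorem cross_mul_inv_of_to_front {n : ℕ} (e g : Equiv.Perm (Fin n)) (s : Fin n → Bool)
    {b : Fin n} (hb : s b = true) (h1 : ∀ x, s x = false → g x = x)
    (h2 : ∀ x, s (g x) = s x)
    (h3 : ∀ i j, s i = true → s j = true → (g j < g i ↔ i ≠ b ∧ (j = b ∨ j < i))) :
    cross (e * g⁻¹) s + negRank s b = cross e s + 2 * numBelow e s b := by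
  have h1' : ∀ x, s x = false → g.symm x = x := fun x hx => by
    rw [Equiv.symm_apply_eq, h1 x hx]
  have inj : ∀ x, x ≠ b → (e x : ℕ) ≠ e b := fun x hx h => hx (e.injective (Fin.ext h))
  have inj' : ∀ x, x ≠ b → (x : ℕ) ≠ b := fun x hx h => hx (Fin.ext h)
  rw [cross_eq_sum, cross_eq_sum]
  have k1 : (∑ i, ∑ j, if s i = false ∧ s j = false ∧
        ((i < j ∧ j ≤ (e * g⁻¹) i ∧ (e * g⁻¹) i < (e * g⁻¹) j) ∨
          (j < i ∧ (e * g⁻¹) i < j ∧ (e * g⁻¹) j < (e * g⁻¹) i)) then 1 else 0) =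
      ∑ i, ∑ j, if s i = false ∧ s j = false ∧
        ((i < j ∧ j ≤ e i ∧ e i < e j) ∨ (j < i ∧ e i < j ∧ e j < e i)) then 1 else 0 := by
    refine Finset.sum_congr rfl fun i _ => Finset.sum_congr rfl fun j _ => if_congr ?_ rfl rfl
    refine and_congr_right fun hi => and_congr_right fun hj => ?_
    simp [h1' i hi, h1' j hj]
  have k2 : (∑ j, ∑ i, if s i = true ∧ s j = false ∧ j ≤ (e * g⁻¹) i ∧
        (e * g⁻¹) i < (e * g⁻¹) j then 1 else 0) =
      ∑ j, ∑ i, if s i = true ∧ s j = false ∧ j ≤ e i ∧ e i < e j then 1 else 0 := by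
    refine Finset.sum_congr rfl fun j _ => ?_
    rw [← Equiv.sum_comp g]
    refine Finset.sum_congr rfl fun i _ => if_congr ?_ rfl rfl
    rw [h2]
    refine and_congr_right fun hi => and_congr_right fun hj => ?_
    simp [h1' j hj]
  have k3 : (∑ i, ∑ j, if s i = false ∧ s j = true ∧ j < i ∧ (e * g⁻¹) i < j then 1 else 0) =
      ∑ i, ∑ j, if s i = false ∧ s j = true ∧ j < i ∧ e i < j then 1 else 0 := by
    refine Finset.sum_congr rfl fun i _ => Finset.sum_congr rfl fun j _ => if_congr ?_ rfl rfl
    refine and_congr_right fun hi => ?_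
    simp [h1' i hi]
  -- Substituting `g` for both indices restores the values of `e` and moves the change into the
  -- order of positions.
  have k4 : (∑ i, ∑ j, if s i = true ∧ s j = true ∧ j < i ∧ (e * g⁻¹) i < (e * g⁻¹) j
        then 1 else 0) =
      ∑ i, ∑ j, if s i = true ∧ s j = true ∧ (i ≠ b ∧ (j = b ∨ j < i)) ∧ e i < e j
        then 1 else 0 := by
    rw [← Equiv.sum_comp g]
    refine Finset.sum_congr rfl fun i _ => ?_
    rw [← Equiv.sum_comp g]
    refine Finset.sum_congr rfl fun j _ => if_congr ?_ rfl rfl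
    rw [h2, h2]
    refine and_congr_right fun hi => and_congr_right fun hj => ?_
    rw [h3 i j hi hj]
    simp
  have k5 : ∀ i j, (if s i = true ∧ s j = true ∧ (i ≠ b ∧ (j = b ∨ j < i)) ∧ e i < e j
        then 1 else 0)
      + (if i = b then (if s j = true ∧ j < b ∧ e b < e j then 1 else 0) else 0)
      + (if j = b then (if s i = true ∧ b < i ∧ e i < e b then 1 else 0) else 0)
      = (if s i = true ∧ s j = true ∧ j < i ∧ e i < e j then 1 else 0)
      + (if j = b then (if s i = true ∧ e i < e b then 1 else 0) else 0) := by
    intro i j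
    by_cases hi : i = b
    · subst hi; by_cases hj : j = i
      · subst hj; simp
      · simp [hj, hb]
    · by_cases hj : j = b
      · subst hj; simp [hi, hb, add_comm]
      · simp [hi, hj]
  have k5' := Finset.sum_congr rfl fun i (_ : i ∈ Finset.univ) =>
    Finset.sum_congr rfl fun j (_ : j ∈ Finset.univ) => k5 i j
  simp only [Finset.sum_add_distrib] at k5'
  simp only [Finset.sum_ite_irrel, Finset.sum_const_zero, Finset.sum_ite_eq', Finset.mem_univ,
    if_true] at k5'
  have k6 : ∀ x, (if s x = true ∧ e x < e b then 1 else 0) + (if s x = true ∧ x < b then 1 else 0)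
      = (if s x = true ∧ x < b ∧ e b < e x then 1 else 0)
      + (if s x = true ∧ b < x ∧ e x < e b then 1 else 0)
      + 2 * (if s x = true ∧ x < b ∧ e x < e b then 1 else 0) := by
    intro x
    by_cases hx : x = b
    · subst hx; simp
    · have h1 := inj x hx
      have h2 := inj' x hx
      simp only [Fin.lt_def]
      cases h : s x <;> simp only [true_and, false_and, if_false, reduceCtorEq]
      split_ifs <;> omega
  have k6' := Finset.sum_congr rfl fun x (_ : x ∈ Finset.univ) => k6 x
  simp only [Finset.sum_add_distrib, ← Finset.mul_sum] at k6'
  simp only [k1, k2, k3, k4, numBelow, negRank]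
  omega

theorem weakExc_mul_inv {n : ℕ} (e g : Equiv.Perm (Fin n)) (s : Fin n → Bool)
    (h1 : ∀ x, s x = false → g x = x) : weakExc (e * g⁻¹) s = weakExc e s := by
  refine Finset.sum_congr rfl fun x _ => if_congr (and_congr_right fun hx => ?_) rfl rfl
  have : g.symm x = x := by rw [Equiv.symm_apply_eq, h1 x hx]
  simp [this]

/-- Right multiplication by `g⁻¹` permutes all `e` for fixed signs, so the dependence on `e` through
`numBelow` averages out to the constant `negRank s b`. -/
theorem sum_pow_cross_add_numBelow {A : Type*} [CommSemiring A] {n : ℕ} (x y : A)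
    (s : Fin n → Bool) {b : Fin n} (hb : s b = true) :
    ∑ e, x ^ weakExc e s * y ^ (cross e s + 2 * numBelow e s b) =
      y ^ negRank s b * ∑ e, x ^ weakExc e s * y ^ cross e s := by
  obtain ⟨g, h1, h2, h3⟩ := exists_perm_to_front s hb
  rw [← Equiv.sum_comp (Equiv.mulRight g⁻¹) fun e => x ^ weakExc e s * y ^ cross e s,
    Finset.mul_sum]
  refine Finset.sum_congr rfl fun e _ => ?_
  rw [← cross_mul_inv_of_to_front e g s hb h1 h2 h3, Equiv.coe_mulRight,
    weakExc_mul_inv e g s h1]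
  ring

theorem sum_ite_eq_sum_orderIso {M : Type*} [AddCommMonoid M] {n k : ℕ} {s : Fin n → Bool}
    (f : Fin k ≃o {x // s x = true}) (F : Fin n → M) :
    ∑ b, (if s b = true then F b else 0) = ∑ i, F (f i) := by
  rw [← Finset.sum_filter, Finset.sum_subtype (p := fun x => s x = true) _ (by simp)]
  exact (Equiv.sum_comp f.toEquiv fun x => F x).symm

/-- The ranks of the negative positions are `0, …, numNeg s - 1`, each taken once; this produces the
q-integer in `D`. -/
theorem sum_pow_negRank {A : Type*} [CommSemiring A] {n : ℕ} (y : A) (s : Fin n → Bool) :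
    ∑ b, (if s b = true then y ^ negRank s b else 0) = ∑ i ∈ Finset.range (numNeg s), y ^ i := by
  let f : Fin _ ≃o {x // s x = true} := monoEquivOfFin {x // s x = true} rfl
  have hrank : ∀ i, negRank s (f i) = i := by
    intro i
    have := sum_ite_eq_sum_orderIso f fun j => if j < (f i : Fin n) then 1 else 0
    simp only [← ite_and, Subtype.coe_lt_coe, f.lt_iff_lt] at this
    rw [negRank, this, Finset.sum_boole, Finset.filter_gt_eq_Iio, Fin.card_Iio]
    rfl
  have hcard : numNeg s = Fintype.card {x // s x = true} := by
    rw [numNeg, sum_ite_eq_sum_orderIso f fun _ => 1]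
    simp
  rw [sum_ite_eq_sum_orderIso f, hcard, Finset.sum_range]
  simp only [hrank]

/-! ### The q-derivative and the recurrence -/

theorem qDeriv_C_mul (a : ℤ[X]) (f : ℤ[X][X]) : qDeriv (C a * f) = C a * qDeriv f := by
  rw [← smul_eq_C_mul, map_smul, smul_eq_C_mul]

theorem qDeriv_t_pow (m : ℕ) :
    qDeriv (t ^ m) = (∑ i ∈ Finset.range m, q ^ i) * t ^ (m - 1) := by
  rw [qDeriv, t, ← monomial_one_right_eq_X_pow, Polynomial.lsum_apply,
    Polynomial.sum_monomial_index _ _ (by simp), LinearMap.smul_apply,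
    smul_eq_C_mul, monomial_one_right_eq_X_pow, map_sum]
  simp [q]

theorem qDeriv_one_add_t_mul (f : ℤ[X][X]) :
    qDeriv ((1 + t) * f) = f + (1 + q * t) * qDeriv f := by
  refine (qDeriv_unique _ _ ?_).symm
  have h := qDeriv_spec f
  have : ((1 + t) * f).comp (q * t) = (1 + q * t) * f.comp (q * t) := by
    simp [mul_comp, t, add_comp]
  rw [this]
  linear_combination (1 + q * t) * h

/-- The generating polynomial of signed permutations by signed weak excedances, number of
negative entries and crossings. -/
noncomputable def signedSum (n : ℕ) : ℤ[X][X] :=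
  ∑ e : Equiv.Perm (Fin n), ∑ s : Fin n → Bool,
    (-1) ^ weakExc e s * t ^ numNeg s * q ^ cross e s

theorem qDeriv_signedSum (n : ℕ) :
    qDeriv (signedSum n) = ∑ e : Equiv.Perm (Fin n), ∑ s : Fin n → Bool,
      (-1) ^ weakExc e s * q ^ cross e s *
        ((∑ i ∈ Finset.range (numNeg s), q ^ i) * t ^ (numNeg s - 1)) := by
  simp only [signedSum, map_sum]
  refine Finset.sum_congr rfl fun e _ => Finset.sum_congr rfl fun s _ => ?_
  have : (-1 : ℤ[X][X]) ^ weakExc e s * q ^ cross e s = C ((-1) ^ weakExc e s * X ^ cross e s) := by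
    simp [q]
  rw [mul_right_comm, this, qDeriv_C_mul, qDeriv_t_pow]

/-- Groups sign vectors into pairs differing only at `b`, each represented by its member that is
negative at `b`. -/
theorem sum_bool_update {n : ℕ} {M : Type*} [AddCommMonoid M] (b : Fin n)
    (F : (Fin n → Bool) → M) :
    ∑ s, F s = ∑ s, if s b = true then F s + F (Function.update s b false) else 0 := by
  have hflip : Function.Involutive fun s : Fin n → Bool => Function.update s b (!s b) := by
    intro s; simp
  have h1 : ∑ s, (if s b = true then F (Function.update s b false) else 0) =
      ∑ s, if s b = true then 0 else F s := by
    rw [← Equiv.sum_comp hflip.toPerm]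
    refine Finset.sum_congr rfl fun s _ => ?_
    cases h : s b <;> simp [h]
    rw [← h, Function.update_eq_self]
  have h2 : ∀ s : Fin n → Bool,
      (if s b = true then F s + F (Function.update s b false) else 0) =
      (if s b = true then F s else 0) +
        if s b = true then F (Function.update s b false) else 0 := by
    intro s; split_ifs <;> simp
  simp only [h2, Finset.sum_add_distrib, h1]
  rw [← Finset.sum_add_distrib]
  refine Finset.sum_congr rfl fun s _ => ?_
  split_ifs <;> simp

theorem numNeg_update_false {n : ℕ} (s : Fin n → Bool) {b : Fin n} (hb : s b = true) :
    numNeg s = numNeg (Function.update s b false) + 1 := by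
  have : ∀ x, (if s x = true then 1 else 0) =
      (if Function.update s b false x = true then 1 else 0) + if x = b then 1 else 0 := by
    intro x
    by_cases h : x = b
    · subst h; simp [hb]
    · simp [h]
  simp only [numNeg, this, Finset.sum_add_distrib]
  simp

theorem numBelow_update {n : ℕ} (e : Equiv.Perm (Fin n)) (s : Fin n → Bool) (b : Fin n)
    (c : Bool) : numBelow e (Function.update s b c) b = numBelow e s b := by
  refine Finset.sum_congr rfl fun x _ => if_congr ?_ rfl rfl
  by_cases h : x = b
  · subst h; simp
  · simp [h]

theorem sum_perm_succ_sum_cons {n : ℕ} {M : Type*} [AddCommMonoid M]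
    (F : Equiv.Perm (Fin (n + 1)) → (Fin (n + 1) → Bool) → M) :
    ∑ e, ∑ s, F e s =
      ∑ c : Bool, ((∑ e, ∑ s, F (Equiv.Perm.decomposeFin.symm (0, e)) (Fin.cons c s)) +
        ∑ e : Equiv.Perm (Fin n), ∑ b, ∑ s,
          F (Equiv.Perm.decomposeFin.symm ((e b).succ, e)) (Fin.cons c s)) := by
  have hs : ∀ e, ∑ s, F e s = ∑ c : Bool, ∑ s : Fin n → Bool, F e (Fin.cons c s) := by
    intro e
    rw [← Equiv.sum_comp (Fin.consEquiv fun _ : Fin (n + 1) => Bool), Fintype.sum_prod_type]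
    rfl
  simp only [hs]
  rw [Finset.sum_comm]
  refine Finset.sum_congr rfl fun c _ => ?_
  rw [← Equiv.sum_comp Equiv.Perm.decomposeFin.symm, Fintype.sum_prod_type, Fin.sum_univ_succ,
    Finset.sum_comm (s := (Finset.univ : Finset (Fin n)))]
  congr 1
  refine Finset.sum_congr rfl fun e _ => ?_
  -- The nonzero value at position `0` is indexed by the `b` with value `e b`, the position that
  -- receives `0` instead.
  exact (Equiv.sum_comp e fun a => ∑ s : Fin n → Bool,
    F (Equiv.Perm.decomposeFin.symm (a.succ, e)) (Fin.cons c s)).symm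

/-- The case where the smallest value is not in the smallest position: the sign of `b` gives `1 + q
t`, and the choice of `b` gives the q-derivative. -/
theorem sum_update_true_eq {n : ℕ} :
    ∑ e : Equiv.Perm (Fin n), ∑ b, ∑ s : Fin n → Bool,
      (-1) ^ weakExc e (Function.update s b true) * t ^ numNeg s *
        q ^ (cross e (Function.update s b true) + 2 * numBelow e s b +
          (if s b = true then 1 else 0)) = (1 + q * t) * qDeriv (signedSum n) := by
  have h1 : ∀ (e : Equiv.Perm (Fin n)) (b : Fin n), (∑ s : Fin n → Bool,
      (-1) ^ weakExc e (Function.update s b true) * t ^ numNeg s *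
        q ^ (cross e (Function.update s b true) + 2 * numBelow e s b +
          (if s b = true then 1 else 0))) =
      ∑ s : Fin n → Bool, if s b = true then (1 + q * t) * (t ^ (numNeg s - 1) *
        ((-1) ^ weakExc e s * q ^ (cross e s + 2 * numBelow e s b))) else 0 := by
    intro e b
    rw [sum_bool_update b]
    refine Finset.sum_congr rfl fun s _ => ?_
    by_cases hb : s b = true
    · have hu : Function.update s b true = s := by rw [← hb, Function.update_eq_self]
      simp only [hb, if_true, hu, Function.update_idem, Function.update_self, numBelow_update,
        numNeg_update_false s hb, Nat.add_sub_cancel, Bool.false_eq_true, if_false]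
      ring
    · simp [hb]
  simp only [h1]
  rw [qDeriv_signedSum, Finset.sum_comm, Finset.mul_sum]
  have h2 : ∀ b : Fin n, (∑ e : Equiv.Perm (Fin n), ∑ s : Fin n → Bool,
      if s b = true then (1 + q * t) * (t ^ (numNeg s - 1) *
        ((-1) ^ weakExc e s * q ^ (cross e s + 2 * numBelow e s b))) else 0) =
      ∑ e : Equiv.Perm (Fin n), ∑ s : Fin n → Bool,
        if s b = true then (1 + q * t) * (t ^ (numNeg s - 1) *
          (q ^ negRank s b * ((-1) ^ weakExc e s * q ^ cross e s))) else 0 := by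
    intro b
    -- The rearrangement depends on `s` and `b`, so both must be fixed before summing over `e`.
    rw [Finset.sum_comm]
    conv_rhs => rw [Finset.sum_comm]
    refine Finset.sum_congr rfl fun s _ => ?_
    by_cases hb : s b = true
    · simp only [hb, if_true, ← Finset.mul_sum]
      rw [sum_pow_cross_add_numBelow (-1) q s hb]
    · simp [hb]
  simp only [h2]
  rw [Finset.sum_comm]
  refine Finset.sum_congr rfl fun e _ => ?_
  rw [Finset.sum_comm, Finset.mul_sum]
  refine Finset.sum_congr rfl fun s _ => ?_
  rw [← sum_pow_negRank, Finset.sum_mul, Finset.mul_sum, Finset.mul_sum]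
  refine Finset.sum_congr rfl fun b _ => ?_
  split_ifs
  · ring
  · simp

theorem signedSum_succ (n : ℕ) :
    signedSum (n + 1) = (t - 1) * qDeriv ((1 + t) * signedSum n) := by
  rw [qDeriv_one_add_t_mul, ← sum_update_true_eq]
  conv_lhs => rw [signedSum, sum_perm_succ_sum_cons]
  simp only [weakExc_decomposeFin_zero, weakExc_decomposeFin_succ, cross_decomposeFin_zero,
    cross_decomposeFin_succ, numNeg_cons, Fintype.sum_bool, if_true, if_false, reduceCtorEq,
    Bool.true_eq_false, zero_add, pow_add _ 1, pow_one, mul_assoc, mul_left_comm _ t,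
    ← Finset.mul_sum]
  simp only [signedSum, mul_assoc]
  ring

theorem signedSum_zero : signedSum 0 = 1 := by
  simp [signedSum, weakExc, numNeg, cross]

/-! ### Comparison of signs with `R` -/

/-- `(D (t² - 1))^m 1`. -/
noncomputable def signedR (m : ℕ) : ℤ[X][X] :=
  (fun f => qDeriv ((t ^ 2 - 1) * f))^[m] 1

theorem signedSum_eq (m : ℕ) : signedSum (m + 1) = (t - 1) * signedR m := by
  induction m with
  | zero =>
    rw [signedSum_succ, signedSum_zero, qDeriv_one_add_t_mul]
    have : qDeriv 1 = 0 := by simpa using qDeriv_t_pow 0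
    simp [this, signedR]
  | succ m ih =>
    rw [signedSum_succ, ih, signedR, signedR, Function.iterate_succ_apply']
    congr 2
    ring

theorem coeff_qDeriv (f : ℤ[X][X]) (k : ℕ) :
    (qDeriv f).coeff k = (∑ i ∈ Finset.range (k + 1), X ^ i) * f.coeff (k + 1) := by
  induction f using Polynomial.induction_on' with
  | add f g hf hg => rw [map_add, coeff_add, hf, hg, coeff_add, mul_add]
  | monomial m a =>
    have : (monomial m a : ℤ[X][X]) = C a * t ^ m := (C_mul_X_pow_eq_monomial).symm
    have hq : (∑ i ∈ Finset.range m, (q : ℤ[X][X]) ^ i) = C (∑ i ∈ Finset.range m, X ^ i) := by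
      simp [q]
    rw [this, qDeriv_C_mul, qDeriv_t_pow, hq, t]
    simp only [coeff_C_mul, coeff_X_pow]
    rcases m with _ | m
    · simp
    · by_cases h : k = m
      · subst h; simp [mul_comm]
      · simp [h]

theorem coeff_signedR_succ (m k : ℕ) : (signedR (m + 1)).coeff k =
    (∑ i ∈ Finset.range (k + 1), X ^ i) *
      ((if k = 0 then 0 else (signedR m).coeff (k - 1)) - (signedR m).coeff (k + 1)) := by
  rw [signedR, Function.iterate_succ_apply', coeff_qDeriv, ← signedR, sub_mul, one_mul, coeff_sub,
    t, coeff_X_pow_mul']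
  rcases k with _ | k <;> simp

theorem coeff_R_succ (m k : ℕ) : (R (m + 1)).coeff k =
    (∑ i ∈ Finset.range (k + 1), X ^ i) *
      ((if k = 0 then 0 else (R m).coeff (k - 1)) + (R m).coeff (k + 1)) := by
  rw [R, pow_succ', Module.End.mul_apply, ← R, LinearMap.add_apply, Module.End.mul_apply,
    Module.End.mul_apply, coeff_add, coeff_qDeriv, coeff_qDeriv]
  have : mulT (mulT (R m)) = X ^ 2 * R m := by
    simp only [mulT, LinearMap.mulLeft_apply, t]; ring
  rw [this, coeff_X_pow_mul']
  rcases k with _ | k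
  · simp
  · simp; ring

/-- Each operator step changes the degree by one. Reaching `t^k` in `m = k + 2 * j` steps takes `j`
lowerings, each with an extra sign in `signedR`; other degrees are unreachable. -/
theorem coeff_signedR_and_R (m k : ℕ) :
    (∀ j, m = k + 2 * j → (signedR m).coeff k = (-1) ^ j * (R m).coeff k) ∧
    ((m < k ∨ ¬ Even (m + k)) → (signedR m).coeff k = 0 ∧ (R m).coeff k = 0) := by
  induction m generalizing k with
  | zero =>
    have h1 : signedR 0 = 1 := rfl
    have h2 : R 0 = 1 := by simp [R]
    rw [h1, h2]
    constructor
    · intro j hj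
      have : j = 0 := by omega
      subst this; simp
    · intro h
      have : k ≠ 0 := by rintro rfl; simp at h
      simp [coeff_one, this]
  | succ m ih =>
    rw [coeff_signedR_succ, coeff_R_succ]
    constructor
    · intro j hj
      have h1 : (signedR m).coeff (k + 1) = -((-1) ^ j * (R m).coeff (k + 1)) := by
        -- With no lowering available, degree `k + 1` exceeds `m` and the coefficient vanishes;
        -- otherwise the last lowering accounts for one sign.
        rcases j with _ | j
        · obtain ⟨h1, h2⟩ := (ih (k + 1)).2 (Or.inl (by omega))
          rw [h1, h2]; simp
        · rw [(ih (k + 1)).1 j (by omega)]; ring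
      rw [h1]
      split_ifs with hk
      · ring
      · rw [(ih (k - 1)).1 j (by omega)]; ring
    · intro h
      obtain ⟨h1, h2⟩ := (ih (k + 1)).2 (by grind)
      rw [h1, h2]
      split_ifs with hk
      · simp
      · obtain ⟨h1, h2⟩ := (ih (k - 1)).2 (by grind)
        rw [h1, h2]; simp

theorem coeff_signedSum (m k : ℕ) : (-1) ^ (k / 2) * (signedSum (m + 1)).coeff k =
    (((-1) ^ ((m + 2) / 2) + (-1) ^ ((m + 1) / 2) * t) * R m).coeff k := by
  have h1 : (signedSum (m + 1)).coeff k =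
      (if k = 0 then 0 else (signedR m).coeff (k - 1)) - (signedR m).coeff k := by
    rw [signedSum_eq, sub_mul, one_mul, coeff_sub, t, ← pow_one (X : ℤ[X][X]), coeff_X_pow_mul']
    rcases k with _ | k <;> simp
  have hC : ∀ i, ((-1) ^ i : ℤ[X][X]) = C ((-1) ^ i) := by intro i; simp
  have h2 : (((-1) ^ ((m + 2) / 2) + (-1) ^ ((m + 1) / 2) * t) * R m).coeff k =
      (-1) ^ ((m + 2) / 2) * (R m).coeff k +
        (-1) ^ ((m + 1) / 2) * (if k = 0 then 0 else (R m).coeff (k - 1)) := by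
    rw [add_mul, coeff_add, mul_assoc, hC, hC, coeff_C_mul, coeff_C_mul, t,
      ← pow_one (X : ℤ[X][X]), coeff_X_pow_mul']
    rcases k with _ | k <;> simp
  rw [h1, h2]
  by_cases hmk : m + 1 < k
  · have a := (coeff_signedR_and_R m k).2 (by omega)
    have b := (coeff_signedR_and_R m (k - 1)).2 (by omega)
    rw [a.1, a.2, b.1, b.2]; simp
  -- Parity leaves just one of the two terms of `(t - 1) * signedR m`, and on the other side the
  -- corresponding term in `R m`.
  by_cases hpar : Even (m + k)
  · have b : (if k = 0 then 0 else (signedR m).coeff (k - 1)) = 0 ∧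
        (if k = 0 then 0 else (R m).coeff (k - 1)) = 0 := by
      split_ifs with hk
      · simp
      · exact (coeff_signedR_and_R m (k - 1)).2 (by grind)
    obtain ⟨j, hj⟩ : ∃ j, m = k + 2 * j := ⟨(m - k) / 2, by grind⟩
    rw [b.1, b.2, (coeff_signedR_and_R m k).1 j hj, show (m + 2) / 2 = k / 2 + j + 1 by omega]
    ring
  · have a := (coeff_signedR_and_R m k).2 (by grind)
    rw [a.1, a.2]
    split_ifs with hk
    · simp
    · obtain ⟨j, hj⟩ : ∃ j, m = (k - 1) + 2 * j := ⟨(m - (k - 1)) / 2, by grind⟩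
      rw [(coeff_signedR_and_R m (k - 1)).1 j hj, show (m + 1) / 2 = k / 2 + j by omega]
      ring

/-! ### Encoding the signed permutations of `[±n]` -/

/-- The element `i + 1` of `[±n]`. -/
noncomputable def posElt {n : ℕ} (i : Fin n) : pm n :=
  ⟨(i : ℤ) + 1, by have := i.isLt; simp only [Finset.mem_erase, Finset.mem_Icc]; omega⟩

theorem posElt_coe {n : ℕ} (i : Fin n) : (posElt i : ℤ) = i + 1 := rfl

theorem pm_bounds {n : ℕ} (x : pm n) : (x : ℤ) ≠ 0 ∧ -(n : ℤ) ≤ x ∧ (x : ℤ) ≤ n := by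
  have := x.2
  simpa only [Finset.mem_erase, Finset.mem_Icc] using this

/-- The index `|x| - 1` of an element of `[±n]`. -/
noncomputable def absIdx {n : ℕ} (x : pm n) : Fin n :=
  ⟨(x : ℤ).natAbs - 1, by have := pm_bounds x; omega⟩

theorem absIdx_coe {n : ℕ} (x : pm n) : ((absIdx x : ℕ) : ℤ) = |(x : ℤ)| - 1 := by
  have := pm_bounds x
  simp only [absIdx, Int.abs_eq_natAbs]
  omega

theorem absIdx_posElt {n : ℕ} (i : Fin n) : absIdx (posElt i) = i := by
  have h := absIdx_coe (posElt i)
  rw [posElt_coe] at h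
  ext
  rw [abs_of_pos (by omega)] at h
  omega

theorem exists_posElt {n : ℕ} (x : pm n) :
    ∃ i : Fin n, (x : ℤ) = posElt i ∨ (x : ℤ) = -(posElt i : ℤ) := by
  refine ⟨absIdx x, ?_⟩
  rw [posElt_coe, absIdx_coe]
  rcases abs_choice (x : ℤ) with h | h <;> rw [h] <;> omega

/-- The value at `x` of the signed permutation with absolute values `e` and signs `s`. -/
noncomputable def signedValue {n : ℕ} (e : Equiv.Perm (Fin n)) (s : Fin n → Bool) (x : pm n) : ℤ :=
  if (0 < (x : ℤ)) ↔ s (absIdx x) = true then -((e (absIdx x) : ℤ) + 1)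
  else (e (absIdx x) : ℤ) + 1

theorem signedValue_mem {n : ℕ} (e : Equiv.Perm (Fin n)) (s : Fin n → Bool) (x : pm n) :
    signedValue e s x ∈ pm n := by
  have := (e (absIdx x)).isLt
  simp only [signedValue, Finset.mem_erase, Finset.mem_Icc]
  split_ifs <;> omega

theorem signedValue_injective {n : ℕ} (e : Equiv.Perm (Fin n)) (s : Fin n → Bool) :
    Function.Injective fun x : pm n => (⟨signedValue e s x, signedValue_mem e s x⟩ : pm n) := by
  intro x y h
  have h' : signedValue e s x = signedValue e s y := congrArg Subtype.val h
  have hidx : absIdx x = absIdx y := by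
    apply e.injective
    simp only [signedValue] at h'
    ext
    split_ifs at h' <;> omega
  have habs : |(x : ℤ)| = |(y : ℤ)| := by
    have h1 := absIdx_coe x
    have h2 := absIdx_coe y
    rw [hidx] at h1
    omega
  have hx := (pm_bounds x).1
  have hy := (pm_bounds y).1
  simp only [signedValue, hidx] at h'
  ext
  rcases abs_eq_abs.mp habs with h1 | h1
  · exact h1
  · rw [h1] at h'
    cases hs : s (absIdx y) <;> simp only [hs, iff_true, iff_false, reduceCtorEq] at h' <;>
      split_ifs at h' <;> omega

/-- The signed permutation with absolute values `e` and signs `s`. -/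
noncomputable def signedPerm {n : ℕ} (p : Equiv.Perm (Fin n) × (Fin n → Bool)) :
    Equiv.Perm (pm n) :=
  Equiv.ofBijective _ (Finite.injective_iff_bijective.mp (signedValue_injective p.1 p.2))

theorem signedPerm_coe {n : ℕ} (p : Equiv.Perm (Fin n) × (Fin n → Bool)) (x : pm n) :
    (signedPerm p x : ℤ) = signedValue p.1 p.2 x := rfl

theorem signedPerm_posElt {n : ℕ} (p : Equiv.Perm (Fin n) × (Fin n → Bool)) (i : Fin n) :
    (signedPerm p (posElt i) : ℤ) =
      if p.2 i = true then -((p.1 i : ℤ) + 1) else (p.1 i : ℤ) + 1 := by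
  have : 0 < (posElt i : ℤ) := by rw [posElt_coe]; omega
  rw [signedPerm_coe, signedValue, absIdx_posElt]
  simp [this]

theorem signedPerm_mem {n : ℕ} (p : Equiv.Perm (Fin n) × (Fin n → Bool)) :
    signedPerm p ∈ signedPerms n := by
  simp only [signedPerms, Finset.mem_filter, Finset.mem_univ, true_and]
  intro i j hij
  have hidx : absIdx j = absIdx i := by
    have h1 := absIdx_coe i
    have h2 := absIdx_coe j
    rw [hij, abs_neg] at h2
    ext
    omega
  have hi := (pm_bounds i).1
  rw [signedPerm_coe, signedPerm_coe, signedValue, signedValue, hidx, hij]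
  cases p.2 (absIdx i) <;> simp only [iff_true, iff_false, reduceCtorEq] <;> split_ifs <;> omega

theorem signedPerm_injective {n : ℕ} : Function.Injective (signedPerm (n := n)) := by
  intro p p' h
  have h' : ∀ i, (if p.2 i = true then -((p.1 i : ℤ) + 1) else (p.1 i : ℤ) + 1) =
      if p'.2 i = true then -((p'.1 i : ℤ) + 1) else (p'.1 i : ℤ) + 1 := by
    intro i
    rw [← signedPerm_posElt, ← signedPerm_posElt, h]
  refine Prod.ext (Equiv.ext fun i => Fin.ext ?_) (funext fun i => ?_)
  · have := h' i
    split_ifs at this <;> omega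
  · have := h' i
    cases h1 : p.2 i <;> cases h2 : p'.2 i <;> simp only [h1, h2] at this <;>
      first | rfl | (simp at this; omega)

theorem exists_signedPerm_eq {n : ℕ} {σ : Equiv.Perm (pm n)} (hσ : σ ∈ signedPerms n) :
    ∃ p, signedPerm p = σ := by
  simp only [signedPerms, Finset.mem_filter, Finset.mem_univ, true_and] at hσ
  -- If two positive positions had opposite values, oddness of `σ` would make one the negative of
  -- the other.
  have hinj : Function.Injective fun i : Fin n => absIdx (σ (posElt i)) := by
    intro i j h
    have h1 := absIdx_coe (σ (posElt i))
    have h2 := absIdx_coe (σ (posElt j))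
    simp only at h
    rw [h] at h1
    have habs : |(σ (posElt i) : ℤ)| = |(σ (posElt j) : ℤ)| := by omega
    rcases abs_eq_abs.mp habs with h3 | h3
    · have := σ.injective (Subtype.ext h3)
      rw [← absIdx_posElt i, this, absIdx_posElt]
    · have hmem : -(posElt j : ℤ) ∈ pm n := by
        have := pm_bounds (posElt j)
        simp only [Finset.mem_erase, Finset.mem_Icc]
        omega
      have h4 := hσ (posElt j) ⟨_, hmem⟩ rfl
      have h5 := σ.injective (Subtype.ext (h3.trans h4.symm))
      have h6 := congrArg Subtype.val h5
      simp only [posElt_coe] at h6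
      omega
  let p : Equiv.Perm (Fin n) × (Fin n → Bool) :=
    (Equiv.ofBijective _ (Finite.injective_iff_bijective.mp hinj),
      fun i => decide ((σ (posElt i) : ℤ) < 0))
  have hpos : ∀ i, (signedPerm p (posElt i) : ℤ) = σ (posElt i) := by
    intro i
    have h1 : ((p.1 i : ℕ) : ℤ) = |(σ (posElt i) : ℤ)| - 1 := absIdx_coe _
    rw [signedPerm_posElt, h1]
    simp only [p, decide_eq_true_eq]
    split_ifs with h
    · rw [abs_of_neg h]; ring
    · rw [abs_of_nonneg (not_lt.mp h)]; ring
  refine ⟨p, Equiv.ext fun x => Subtype.ext ?_⟩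
  obtain ⟨i, hi | hi⟩ := exists_posElt x
  · rw [Subtype.ext hi, hpos]
  · have hp := signedPerm_mem p
    simp only [signedPerms, Finset.mem_filter, Finset.mem_univ, true_and] at hp
    rw [hp _ _ hi, hσ _ _ hi, hpos]

theorem sum_signedPerms {n : ℕ} {M : Type*} [AddCommMonoid M] (F : Equiv.Perm (pm n) → M) :
    ∑ σ ∈ signedPerms n, F σ =
      ∑ e : Equiv.Perm (Fin n), ∑ s : Fin n → Bool, F (signedPerm (e, s)) := by
  rw [← Fintype.sum_prod_type']
  exact (Finset.sum_bij (fun p _ => signedPerm p) (fun p _ => signedPerm_mem p)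
    (fun _ _ _ _ h => signedPerm_injective h)
    (fun σ hσ => by obtain ⟨p, hp⟩ := exists_signedPerm_eq hσ; exact ⟨p, Finset.mem_univ _, hp⟩)
    (fun _ _ => rfl)).symm

theorem sum_posElt {n : ℕ} {M : Type*} [AddCommMonoid M] (F : pm n → M)
    (hF : ∀ x : pm n, ¬ 0 < (x : ℤ) → F x = 0) : ∑ i, F (posElt i) = ∑ x, F x := by
  refine Fintype.sum_of_injective posElt
    (fun i j h => by rw [← absIdx_posElt i, h, absIdx_posElt]) _ _ (fun x hx => hF x fun h => hx ?_)
    fun _ => rfl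
  obtain ⟨i, hi | hi⟩ := exists_posElt x
  · exact ⟨i, (Subtype.ext hi).symm⟩
  · rw [posElt_coe] at hi
    omega

theorem neg_signedPerm {n : ℕ} (e : Equiv.Perm (Fin n)) (s : Fin n → Bool) :
    neg (signedPerm (e, s)) = numNeg s := by
  rw [neg, Finset.card_filter, ← sum_posElt _ (fun x hx => by simp [hx]), numNeg]
  refine Finset.sum_congr rfl fun i _ => if_congr ?_ rfl rfl
  simp only [signedPerm_posElt, posElt_coe]
  cases s i <;>
    simp only [if_true, if_false, reduceCtorEq, iff_true, iff_false] <;> omega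

theorem wex_signedPerm {n : ℕ} (e : Equiv.Perm (Fin n)) (s : Fin n → Bool) :
    wex (signedPerm (e, s)) = weakExc e s := by
  rw [wex, Finset.card_filter, ← sum_posElt _ (fun x hx => by simp [hx]), weakExc]
  refine Finset.sum_congr rfl fun i _ => if_congr ?_ rfl rfl
  simp only [signedPerm_posElt, posElt_coe, Fin.le_def]
  cases s i <;>
    simp only [if_true, if_false, reduceCtorEq, true_and, false_and, iff_false] <;> omega

theorem croB_signedPerm {n : ℕ} (e : Equiv.Perm (Fin n)) (s : Fin n → Bool) :
    croB (signedPerm (e, s)) = cross e s := by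
  rw [croB, Finset.card_filter, Fintype.sum_prod_type, ← sum_posElt _ (fun x hx => by
    simp [IsCrossing, hx]), cross]
  refine Finset.sum_congr rfl fun i _ => ?_
  rw [← sum_posElt _ (fun x hx => by simp [IsCrossing, hx])]
  refine Finset.sum_congr rfl fun j _ => if_congr ?_ rfl rfl
  simp only [IsCrossing, CrossCond, signedPerm_posElt, posElt_coe]
  cases s i <;> cases s j <;>
    simp only [if_true, if_false, reduceCtorEq, true_and, false_and, or_false, false_or] <;> omega

theorem sum_evenSignedPerms {n : ℕ} {M : Type*} [AddCommMonoid M] (F : Equiv.Perm (pm n) → M) :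
    ∑ σ ∈ evenSignedPerms n, F σ =
      ∑ e : Equiv.Perm (Fin n), ∑ s : Fin n → Bool,
        if Even (numNeg s) then F (signedPerm (e, s)) else 0 := by
  rw [evenSignedPerms, Finset.sum_filter, sum_signedPerms]
  simp only [neg_signedPerm]

/-! ### Coefficients of the sums in the theorem -/

/-- The floor splits as `w + m / 2`, and only `k = m` contributes; the flag sign thus becomes the
weak excedance sign times a factor depending on `k` alone. -/
theorem coeff_term (w m c k : ℕ) :
    ((-1) ^ ((2 * w + m) / 2) * t ^ m * q ^ c).coeff k =
      (-1) ^ (k / 2) * ((-1) ^ w * t ^ m * q ^ c).coeff k := by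
  have h : ∀ a, ((-1) ^ a * t ^ m * q ^ c : ℤ[X][X]) = C ((-1) ^ a * X ^ c) * X ^ m := by
    intro a
    simp only [q, t, map_mul, map_pow, map_neg, map_one]
    ring
  rw [h, h, coeff_C_mul, coeff_C_mul, coeff_X_pow]
  split_ifs with hk
  · rw [hk, show (2 * w + m) / 2 = w + m / 2 by omega]
    ring
  · simp

theorem coeff_sum_signedPerms (n k : ℕ) :
    (∑ σ ∈ signedPerms n, (-1) ^ (fwex σ / 2) * t ^ neg σ * q ^ croB σ).coeff k =
      (-1) ^ (k / 2) * (signedSum n).coeff k := by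
  simp only [sum_signedPerms, fwex, neg_signedPerm, wex_signedPerm, croB_signedPerm, signedSum,
    finsetSum_coeff, coeff_term, Finset.mul_sum]

theorem coeff_sum_evenSignedPerms (n k : ℕ) :
    (∑ σ ∈ evenSignedPerms n, (-1) ^ (fwex σ / 2) * t ^ neg σ * q ^ croB σ).coeff k =
      if Even k then (-1) ^ (k / 2) * (signedSum n).coeff k else 0 := by
  have h : ∀ w m c : ℕ,
      (if Even m then ((-1) ^ w * t ^ m * q ^ c : ℤ[X][X]) else 0).coeff k =
      if Even k then ((-1) ^ w * t ^ m * q ^ c).coeff k else 0 := by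
    intro w m c
    have h0 : ¬ k = m → ((-1) ^ w * t ^ m * q ^ c : ℤ[X][X]).coeff k = 0 := by
      intro hk
      have : ((-1) ^ w * t ^ m * q ^ c : ℤ[X][X]) = C ((-1) ^ w * X ^ c) * X ^ m := by
        simp only [q, t, map_mul, map_pow, map_neg, map_one]
        ring
      rw [this, coeff_C_mul, coeff_X_pow, if_neg hk, mul_zero]
    by_cases hk : k = m
    · subst hk
      split_ifs <;> simp
    · split_ifs <;> simp [h0 hk]
  simp only [sum_evenSignedPerms, fwex, neg_signedPerm, wex_signedPerm, croB_signedPerm, signedSum,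
    finsetSum_coeff, h, coeff_term, Finset.mul_sum]
  split_ifs <;> simp

end SignedCount

theorem theorem1p3 (n : ℕ) (hn : 1 ≤ n) :
    (∑ σ ∈ SignedCount.signedPerms n,
        (-1) ^ (SignedCount.fwex σ / 2) * SignedCount.t ^ SignedCount.neg σ *
          SignedCount.q ^ SignedCount.croB σ =
      ((-1) ^ ((n + 1) / 2) + (-1) ^ (n / 2) * SignedCount.t) * SignedCount.R (n - 1)) ∧
    (∑ σ ∈ SignedCount.evenSignedPerms n,
        (-1) ^ (SignedCount.fwex σ / 2) * SignedCount.t ^ SignedCount.neg σ *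
          SignedCount.q ^ SignedCount.croB σ =
      if Even n then (-1) ^ (n / 2) * SignedCount.t * SignedCount.R (n - 1)
      else (-1) ^ ((n + 1) / 2) * SignedCount.R (n - 1)) := by
  obtain ⟨m, rfl⟩ : ∃ m, n = m + 1 := ⟨n - 1, by omega⟩
  simp only [Nat.add_sub_cancel]
  have hC : ∀ i, ((-1) ^ i : ℤ[X][X]) = C ((-1) ^ i) := by intro i; simp
  have hR : ∀ k i, ¬ Even (m + k) → ((-1) ^ i * SignedCount.R m).coeff k = 0 := by
    intro k i hk
    rw [hC, coeff_C_mul, ((SignedCount.coeff_signedR_and_R m k).2 (Or.inr hk)).2, mul_zero]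
  have htR : ∀ k i, Even (m + k) → ((-1) ^ i * SignedCount.t * SignedCount.R m).coeff k = 0 := by
    intro k i hk
    rw [mul_assoc, hC, coeff_C_mul, SignedCount.t]
    rcases k with _ | k
    · simp
    · rw [coeff_X_mul, ((SignedCount.coeff_signedR_and_R m k).2 (Or.inr (by grind))).2, mul_zero]
  constructor
  · ext1 k
    rw [SignedCount.coeff_sum_signedPerms, SignedCount.coeff_signedSum]
  · ext1 k
    rw [SignedCount.coeff_sum_evenSignedPerms, SignedCount.coeff_signedSum, add_mul, coeff_add]
    -- The two right-hand terms live in degrees of opposite parity, so the even-degree condition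
    -- selects one according to the parity of `m + 1`.
    by_cases hm : Even (m + 1) <;> by_cases hk : Even k <;> simp only [hm, hk, if_true, if_false]
    · rw [hR k _ (by grind), zero_add]
    · rw [htR k _ (by grind)]
    · rw [htR k _ (by grind), add_zero]
    · rw [hR k _ (by grind)]
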